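/- Let $\Phi_{\rm b}$ be a homogeneous Poisson point process in $\mathbb{R}^2$ with intensity $\lambda_{\rm b}\in(0,\infty)$ (the base stations) and let $\Phi_{\rm u}$ be an arbitrary point process in $\mathbb{R}^2$ (the users), that is, a random locally finite counting measure (multiple points and non-stationarity are allowed), independent of $\Phi_{\rm b}$. For $n\ge 0$ let $\mu^{(n)}$ be the $n$-th moment measure of $\Phi_{\rm u}$, the measure on $(\mathbb{R}^2)^n$ with $\mu^{(n)}(A)=\mathbb{E}\big[\sum_{x_1,\dots,x_n\in\Phi_{\rm u}}\mathbf{1}_A(x_1,\dots,x_n)\big]$, so that $\mu^{(n)}(B_1\times\dots\times B_n)=\mathbb{E}[\Phi_{\rm u}(B_1)\cdots\Phi_{\rm u}(B_n)]$. Let $\mathcal{C}_o=\{y:\|y\|\le\|y-t\|\ \text{for all } t\in\Phi_{\rm b}\}$ be the Voronoi cell of the origin $o$ when $\Phi_{\rm b}$ is conditioned to have a point at $o$; that is, expectations below are taken with $(\Phi_{\rm b},\Phi_{\rm u})$ distributed according to $$A\mapsto \frac{\mathbb{E}\big[\sum_{x\in\Phi_{\rm b}\cap W}\mathbf{1}_A(\Phi_{\rm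 b}-x,\Phi_{\rm u})\big]}{\mathbb{E}[\Phi_{\rm b}(W)]},$$ where $W$ is any Borel set with $0<\mathrm{area}(W)<\infty$ (by independence, this is the product of the Palm distribution of $\Phi_{\rm b}$ and the law of $\Phi_{\rm u}$). Then the $n$-th moment of the typical cell load $\Phi_{\rm u}(\mathcal{C}_o)$ is $$\mathbb{E}\big[\Phi_{\rm u}(\mathcal{C}_o)^n\big]=\mathbb{E}\big[\mu^{(n)}(\mathcal{C}_o^n)\big]=\int_{(\mathbb{R}^2)^n}\exp\Big(-\lambda_{\rm b}\,\mathrm{area}\Big(\bigcup_{i=1}^n b(x_i,\|x_i\|)\Big)\Big)\,\mu^{(n)}(\mathrm{d}x_1,\dots,\mathrm{d}x_n),$$ where $b(x,r)$ is the disc of radius $r$ centred at $x$ and all the quantities are values in $[0,\infty]$. -/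

import Mathlib

open MeasureTheory ProbabilityTheory Set Filter
open scoped ENNReal NNReal

noncomputable section

namespace CellLoad

/-- The Euclidean plane. -/
abbrev Plane : Type := EuclideanSpace ℝ (Fin 2)

/-- Realisations of a point process in the plane: Borel measures that take finite integer values on
bounded Borel sets, that is, locally finite counting measures (multiple points are allowed). The
σ-algebra on this type is the standard one, generated by the counts `φ ↦ φ B`, `B` Borel. -/
def PointMeasure : Type :=
  {φ : Measure Plane //
    ∀ B : Set Plane, MeasurableSet B → Bornology.IsBounded B → ∃ k : ℕ, φ B = k}

instance : MeasurableSpace PointMeasure :=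
  inferInstanceAs (MeasurableSpace {φ : Measure Plane //
    ∀ B : Set Plane, MeasurableSet B → Bornology.IsBounded B → ∃ k : ℕ, φ B = k})

namespace PointMeasure

/-- The counting measure underlying a point configuration. -/
def toMeasure (φ : PointMeasure) : Measure Plane := φ.1

theorem exists_count (φ : PointMeasure) {B : Set Plane} (hB : MeasurableSet B)
    (hb : Bornology.IsBounded B) : ∃ k : ℕ, φ.toMeasure B = k := φ.2 B hB hb

theorem measurable_toMeasure : Measurable toMeasure := measurable_subtype_coe

theorem measurable_count {B : Set Plane} (hB : MeasurableSet B) :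
    Measurable fun φ : PointMeasure => φ.toMeasure B :=
  (Measure.measurable_coe hB).comp measurable_toMeasure

instance (φ : PointMeasure) : IsLocallyFiniteMeasure φ.toMeasure where
  finiteAtNhds x := by
    refine ⟨Metric.ball x 1, Metric.ball_mem_nhds x one_pos, ?_⟩
    obtain ⟨k, hk⟩ := φ.exists_count Metric.isOpen_ball.measurableSet
      (Metric.isBounded_ball (x := x) (r := 1))
    rw [hk]
    exact ENNReal.natCast_lt_top k

/-- `t` is a point of the configuration `φ`. -/
def IsPoint (φ : PointMeasure) (t : Plane) : Prop := φ.toMeasure {t} ≠ 0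

/-- The configuration `φ - x`: all points of `φ` are translated by `-x`. -/
def recenter (φ : PointMeasure) (x : Plane) : PointMeasure :=
  ⟨φ.toMeasure.map (fun y => y - x), fun B hB hb => by
    rw [Measure.map_apply (measurable_sub_const x) hB]
    refine φ.exists_count (measurable_sub_const x hB) ?_
    have h : (fun y : Plane => y - x) ⁻¹' B = (fun y => y + x) '' B := by
      ext y
      simp only [mem_preimage, mem_image]
      exact ⟨fun hy => ⟨_, hy, sub_add_cancel y x⟩, by rintro ⟨z, hz, rfl⟩; simpa using hz⟩
    rw [h]
    exact (LipschitzWith.of_dist_le_mul (K := 1) fun a b => by simp).isBounded_image hb⟩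

/-- The closed Voronoi cell of the location `x` with respect to the configuration `φ`. -/
def cell (φ : PointMeasure) (x : Plane) : Set Plane :=
  {y | ∀ t, φ.IsPoint t → ‖y - x‖ ≤ ‖y - t‖}

/-- `φ ↦ φ` as a kernel. -/
def kernel : Kernel PointMeasure Plane := ⟨toMeasure, measurable_toMeasure⟩

theorem kernel_apply (φ : PointMeasure) : kernel φ = φ.toMeasure := rfl

instance : IsSFiniteKernel kernel := by
  classical
  let A : ℕ → Set Plane := disjointed fun k : ℕ => Metric.ball 0 (k : ℝ)
  have hA : ∀ k, MeasurableSet (A k) := fun k =>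
    MeasurableSet.disjointed (fun k => Metric.isOpen_ball.measurableSet) k
  have hAb : ∀ k, Bornology.IsBounded (A k) := fun k =>
    Metric.isBounded_ball.subset (disjointed_subset _ k)
  have hAu : ⋃ k, A k = univ := by rw [iUnion_disjointed]; exact Metric.iUnion_ball_nat 0
  have hS : ∀ k j : ℕ, MeasurableSet {φ : PointMeasure | φ.toMeasure (A k) = j} :=
    fun k j => measurable_count (hA k) (measurableSet_singleton _)
  let κ : ℕ → ℕ → Kernel PointMeasure Plane := fun k j =>
    Kernel.piecewise (hS k j) (kernel.restrict (hA k)) 0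
  have hfin : ∀ k j, IsFiniteKernel (κ k j) := fun k j => by
    refine ⟨j, ENNReal.natCast_lt_top j, fun φ => ?_⟩
    simp only [κ, Kernel.piecewise_apply]
    split_ifs with h
    · rw [Kernel.restrict_apply, Measure.restrict_apply_univ]
      exact le_of_eq h
    · simp
  have h : kernel = Kernel.sum fun k => Kernel.sum fun j => κ k j := by
    ext φ s hs
    simp only [Kernel.sum_apply' _ _ hs]
    have h1 : ∀ k, ∑' j, κ k j φ s = φ.toMeasure.restrict (A k) s := fun k => by
      obtain ⟨j₀, hj₀⟩ := φ.exists_count (hA k) (hAb k)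
      rw [tsum_eq_single j₀]
      · simp only [κ, Kernel.piecewise_apply]
        rw [if_pos (show φ ∈ {φ : PointMeasure | φ.toMeasure (A k) = j₀} from hj₀),
          Kernel.restrict_apply, kernel_apply]
      · intro j hj
        simp only [κ, Kernel.piecewise_apply]
        rw [if_neg]
        · simp
        · intro hj'
          have : (j : ℝ≥0∞) = j₀ := by rw [← hj₀]; exact hj'.symm
          exact hj (by exact_mod_cast this)
    simp_rw [h1]
    rw [← Measure.sum_apply _ hs, ← Measure.restrict_iUnion (disjoint_disjointed _) hA, hAu,
      Measure.restrict_univ, kernel_apply]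
  rw [h]
  infer_instance

/-- Campbell sums `∑_{x ∈ φ} f (φ, x)` are measurable in `φ`. -/
theorem measurable_lintegral {f : PointMeasure → Plane → ℝ≥0∞}
    (hf : Measurable (Function.uncurry f)) :
    Measurable fun φ : PointMeasure => ∫⁻ x, f φ x ∂φ.toMeasure :=
  Measurable.lintegral_kernel_prod_right (κ := kernel) hf

theorem measurable_recenter :
    Measurable fun p : PointMeasure × Plane => p.1.recenter p.2 := by
  refine Measurable.subtype_mk (Measure.measurable_of_measurable_coe _ fun B hB => ?_)
  have h : ∀ p : PointMeasure × Plane, (p.1.toMeasure.map fun y => y - p.2) B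
      = ∫⁻ y, B.indicator 1 (y - p.2) ∂p.1.toMeasure := fun p => by
    rw [Measure.map_apply (measurable_sub_const _) hB,
      ← lintegral_indicator_one (measurable_sub_const _ hB)]
    rfl
  simp_rw [h]
  refine Measurable.lintegral_kernel_prod_right
    (κ := kernel.comap (Prod.fst : PointMeasure × Plane → PointMeasure) measurable_fst)
    (f := fun (p : PointMeasure × Plane) (y : Plane) => B.indicator (1 : Plane → ℝ≥0∞) (y - p.2)) ?_
  exact (measurable_one.indicator hB).comp (measurable_snd.sub (measurable_snd.comp measurable_fst))

theorem measurable_pi (n : ℕ) :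
    Measurable fun φ : PointMeasure => Measure.pi fun _ : Fin n => φ.toMeasure := by
  refine Measure.measurable_of_measurable_coe _ fun s hs => ?_
  let b : ℕ → Set Plane := fun k => Metric.ball 0 (k : ℝ)
  have hb : ∀ k, MeasurableSet (b k) := fun k => Metric.isOpen_ball.measurableSet
  let C : ℕ → Set (Fin n → Plane) := fun k => univ.pi fun _ => b k
  have hC : ∀ k, MeasurableSet (C k) := fun k => MeasurableSet.univ_pi fun _ => hb k
  have hmono : Monotone C := fun i j hij => Set.pi_mono fun _ _ =>
    Metric.ball_subset_ball (by exact_mod_cast hij)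
  have hCu : ⋃ k, C k = univ := by
    refine eq_univ_of_forall fun x => ?_
    obtain ⟨k, hk⟩ := exists_nat_gt ‖x‖
    refine mem_iUnion.2 ⟨k, fun i _ => ?_⟩
    exact mem_ball_zero_iff.2 ((norm_le_pi_norm x i).trans_lt hk)
  have h : ∀ φ : PointMeasure, (Measure.pi fun _ : Fin n => φ.toMeasure) s
      = ⨆ k, (Measure.pi fun _ : Fin n => φ.toMeasure.restrict (b k)) s := fun φ => by
    have : s = ⋃ k, s ∩ C k := by rw [← inter_iUnion, hCu, inter_univ]
    conv_lhs => rw [this]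
    rw [Monotone.measure_iUnion fun i j hij => inter_subset_inter_right _ (hmono hij)]
    refine iSup_congr fun k => ?_
    rw [← Measure.restrict_pi_pi, Measure.restrict_apply hs]
  simp_rw [h]
  refine Measurable.iSup fun k => ?_
  have : ∀ φ : PointMeasure, IsFiniteMeasure (φ.toMeasure.restrict (b k)) := fun φ =>
    ⟨by
      obtain ⟨j, hj⟩ := φ.exists_count (hb k) Metric.isBounded_ball
      rw [Measure.restrict_apply_univ, hj]
      exact ENNReal.natCast_lt_top j⟩
  have hrect : ∀ B : Fin n → Set Plane, (∀ i, MeasurableSet (B i)) →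
      Measurable fun φ : PointMeasure =>
        (Measure.pi fun _ : Fin n => φ.toMeasure.restrict (b k)) (univ.pi B) := fun B hB => by
    simp_rw [Measure.pi_pi, Measure.restrict_apply (hB _)]
    exact Finset.measurable_fun_prod _ fun i _ => measurable_count ((hB i).inter (hb k))
  refine (Measure.measurable_coe hs).comp
    (Measurable.measure_of_isPiSystem generateFrom_pi.symm isPiSystem_pi ?_ ?_)
  · rintro _ ⟨B, hB, rfl⟩
    exact hrect B fun i => hB i (mem_univ i)
  · have := hrect (fun _ => univ) fun _ => MeasurableSet.univ
    simpa only [pi_univ] using this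

end PointMeasure

variable {Ω : Type*} [MeasurableSpace Ω]

/-- `Φ` is a homogeneous Poisson point process of intensity `lam` under `P`: the number of points
in a bounded Borel set `B` is Poisson distributed with mean `lam * area B`, and the numbers of
points in finitely many disjoint bounded Borel sets are independent. -/
structure IsPoissonProcess (P : Measure Ω) (lam : ℝ≥0) (Φ : Ω → PointMeasure) : Prop where
  measurable : Measurable Φ
  map_count : ∀ B : Set Plane, MeasurableSet B → Bornology.IsBounded B →
    P.map (fun ω => (Φ ω).toMeasure B)
      = (poissonMeasure (lam * (volume B).toNNReal)).map (fun k : ℕ => (k : ℝ≥0∞))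
  iIndepFun_count : ∀ (m : ℕ) (B : Fin m → Set Plane), (∀ i, MeasurableSet (B i)) →
    (∀ i, Bornology.IsBounded (B i)) → Pairwise (fun i j => Disjoint (B i) (B j)) →
    iIndepFun (fun i ω => (Φ ω).toMeasure (B i)) P

/-- The `n`-th moment measure of `Φ`, that is, the intensity measure of the `n`-fold product process
`Φⁿ`: a Borel set `A` of `n`-tuples receives the mass `E[∑_{x₁, …, xₙ ∈ Φ} 1_A(x₁, …, xₙ)]`. -/
def momentMeasure (P : Measure Ω) (Φ : Ω → PointMeasure) (n : ℕ) : Measure (Fin n → Plane) :=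
  P.bind fun ω => Measure.pi fun _ : Fin n => (Φ ω).toMeasure

/-- On products of Borel sets the moment measure is `E[Φ(B₁) ⋯ Φ(Bₙ)]`. -/
theorem momentMeasure_pi {P : Measure Ω} {Φ : Ω → PointMeasure} (hΦ : Measurable Φ) (n : ℕ)
    (B : Fin n → Set Plane) (hB : ∀ i, MeasurableSet (B i)) :
    momentMeasure P Φ n (univ.pi B) = ∫⁻ ω, ∏ i, (Φ ω).toMeasure (B i) ∂P := by
  have h : Measurable fun ω => Measure.pi fun _ : Fin n => (Φ ω).toMeasure :=
    (PointMeasure.measurable_pi n).comp hΦ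
  rw [momentMeasure, Measure.bind_apply (MeasurableSet.univ_pi hB) h.aemeasurable]
  simp_rw [Measure.pi_pi]

/-- The Palm distribution (at the origin) of a stationary point process with law `Q`, computed in
an observation window `W`: the law of `φ` seen from a point of `φ` in `W` that is chosen according
to the counting measure,
`A ↦ E[∑_{x ∈ Φ ∩ W} 1_A(Φ - x)] / E[Φ(W)]`. For a stationary process it is the conditional law
given that there is a point at the origin, and it does not depend on the window. -/
def palmLaw (Q : Measure PointMeasure) (W : Set Plane) : Measure PointMeasure :=
  (∫⁻ φ, φ.toMeasure W ∂Q)⁻¹ • Q.bind fun φ => (φ.toMeasure.restrict W).map φ.recenter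

/-- The joint law of the stationary process `Φ`, given that it has a point at the origin, and of a
second process `Ψ` independent of `Φ`:
`A ↦ E[∑_{x ∈ Φ ∩ W} 1_A(Φ - x, Ψ)] / E[Φ(W)]`. By independence (see `typicalLaw_eq_prod`) this is
the product of the Palm distribution of `Φ` and the unchanged law of `Ψ`. -/
def typicalLaw (P : Measure Ω) (Φ Ψ : Ω → PointMeasure) (W : Set Plane) :
    Measure (PointMeasure × PointMeasure) :=
  (∫⁻ ω, (Φ ω).toMeasure W ∂P)⁻¹ •
    P.bind fun ω => ((Φ ω).toMeasure.restrict W).map fun x => ((Φ ω).recenter x, Ψ ω)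

/-- The load of the typical cell, the cell of the origin: the number of points of `ψ` (users) in it,
as a function of the pair `(φ, ψ)` of the configurations of base stations and of users. -/
def cellLoad (p : PointMeasure × PointMeasure) : ℝ≥0∞ := p.2.toMeasure (p.1.cell 0)

/-- The maps whose mixtures define `palmLaw` and `typicalLaw` are measurable. -/
theorem measurable_map_recenter {W : Set Plane} (hW : MeasurableSet W) :
    Measurable fun p : PointMeasure × PointMeasure =>
      (p.1.toMeasure.restrict W).map fun x => (p.1.recenter x, p.2) := by
  have hr : Measurable fun q : (PointMeasure × PointMeasure) × Plane =>
      (q.1.1.recenter q.2, q.1.2) :=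
    (PointMeasure.measurable_recenter.comp
      ((measurable_fst.comp measurable_fst).prodMk measurable_snd)).prodMk
      (measurable_snd.comp measurable_fst)
  refine Measure.measurable_of_measurable_coe _ fun s hs => ?_
  have h : ∀ p : PointMeasure × PointMeasure,
      ((p.1.toMeasure.restrict W).map fun x => (p.1.recenter x, p.2)) s
      = ∫⁻ x, W.indicator 1 x * s.indicator 1 (p.1.recenter x, p.2) ∂p.1.toMeasure := fun p => by
    have hp : Measurable fun x => (p.1.recenter x, p.2) := hr.comp measurable_prodMk_left
    rw [Measure.map_apply hp hs, ← lintegral_indicator_one (hp hs), ← lintegral_indicator hW]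
    refine lintegral_congr fun x => ?_
    by_cases hx : x ∈ W
    · simp only [indicator_of_mem hx, Pi.one_apply, one_mul]
      rfl
    · simp only [indicator_of_notMem hx, zero_mul]
  simp_rw [h]
  refine Measurable.lintegral_kernel_prod_right
    (κ := PointMeasure.kernel.comap
      (Prod.fst : PointMeasure × PointMeasure → PointMeasure) measurable_fst)
    (f := fun (p : PointMeasure × PointMeasure) (x : Plane) =>
      W.indicator (1 : Plane → ℝ≥0∞) x *
        s.indicator (1 : PointMeasure × PointMeasure → ℝ≥0∞) (p.1.recenter x, p.2)) ?_
  exact ((measurable_one.indicator hW).comp measurable_snd).mul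
    ((measurable_one.indicator hs).comp hr)

theorem typicalLaw_eq_prod {P : Measure Ω} [IsProbabilityMeasure P] {Φ Ψ : Ω → PointMeasure}
    (hΦ : Measurable Φ) (hΨ : Measurable Ψ) (hind : IndepFun Φ Ψ P) {W : Set Plane}
    (hW : MeasurableSet W) :
    typicalLaw P Φ Ψ W = (palmLaw (P.map Φ) W).prod (P.map Ψ) := by
  have hpr : IsProbabilityMeasure (P.map Ψ) := Measure.isProbabilityMeasure_map hΨ.aemeasurable
  have hprΦ : IsProbabilityMeasure (P.map Φ) := Measure.isProbabilityMeasure_map hΦ.aemeasurable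
  have hrec : ∀ φ : PointMeasure, Measurable φ.recenter := fun φ =>
    PointMeasure.measurable_recenter.comp measurable_prodMk_left
  have hm := measurable_map_recenter hW
  have hm1 : Measurable fun φ : PointMeasure => (φ.toMeasure.restrict W).map φ.recenter := by
    have h : ∀ φ : PointMeasure, (φ.toMeasure.restrict W).map φ.recenter
        = ((φ.toMeasure.restrict W).map fun x => (φ.recenter x, φ)).map Prod.fst := fun φ => by
      rw [Measure.map_map measurable_fst ((hrec φ).prodMk measurable_const)]
      rfl
    simp_rw [h]
    exact (Measure.measurable_map _ measurable_fst).comp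
      (hm.comp (measurable_id.prodMk measurable_id))
  have hm2 : Measurable fun ω =>
      ((Φ ω).toMeasure.restrict W).map fun x => ((Φ ω).recenter x, Ψ ω) :=
    hm.comp (hΦ.prodMk hΨ)
  refine Measure.ext fun s hs => ?_
  have hsec : Measurable fun φ => P.map Ψ (Prod.mk φ ⁻¹' s) := measurable_measure_prodMk_left hs
  rw [Measure.prod_apply hs, typicalLaw, palmLaw, lintegral_smul_measure,
    Measure.lintegral_bind hm1.aemeasurable hsec.aemeasurable, Measure.smul_apply,
    Measure.bind_apply hs hm2.aemeasurable,
    lintegral_map (PointMeasure.measurable_count hW) hΦ]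
  congr 1
  have hms : Measurable fun p : PointMeasure × PointMeasure =>
      ((p.1.toMeasure.restrict W).map fun x => (p.1.recenter x, p.2)) s :=
    (Measure.measurable_coe hs).comp hm
  calc ∫⁻ ω, (((Φ ω).toMeasure.restrict W).map fun x => ((Φ ω).recenter x, Ψ ω)) s ∂P
      = ∫⁻ p, ((p.1.toMeasure.restrict W).map fun x => (p.1.recenter x, p.2)) s
          ∂(P.map fun ω => (Φ ω, Ψ ω)) := (lintegral_map hms (hΦ.prodMk hΨ)).symm
    _ = ∫⁻ φ, ∫⁻ ψ, ((φ.toMeasure.restrict W).map fun x => (φ.recenter x, ψ)) s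
          ∂(P.map Ψ) ∂(P.map Φ) := by
        rw [(indepFun_iff_map_prod_eq_prod_map_map hΦ.aemeasurable hΨ.aemeasurable).1 hind,
          lintegral_prod _ hms.aemeasurable]
    _ = _ := lintegral_congr fun φ => by
        have hp : Measurable fun q : PointMeasure × Plane => (φ.recenter q.2, q.1) :=
          ((hrec φ).comp measurable_snd).prodMk measurable_fst
        rw [lintegral_map hsec (hrec φ)]
        have h1 : ∀ ψ, ((φ.toMeasure.restrict W).map fun x => (φ.recenter x, ψ)) s
            = ∫⁻ x in W, s.indicator 1 (φ.recenter x, ψ) ∂φ.toMeasure := fun ψ => by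
          have hq : Measurable fun x => (φ.recenter x, ψ) := (hrec φ).prodMk measurable_const
          rw [Measure.map_apply hq hs, ← lintegral_indicator_one (hq hs)]
          rfl
        have h2 : ∀ x, P.map Ψ (Prod.mk (φ.recenter x) ⁻¹' s)
            = ∫⁻ ψ, s.indicator 1 (φ.recenter x, ψ) ∂(P.map Ψ) := fun x => by
          rw [← lintegral_indicator_one (measurable_prodMk_left hs)]
          rfl
        simp_rw [h1, h2]
        exact lintegral_lintegral_swap ((measurable_one.indicator hs).comp hp).aemeasurable

end CellLoad

end

open CellLoad

/-! The point y lies in the cell of the origin iff the open disc around y through the origin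
contains no base station (`mem_cell_zero_iff`). Hence x₁, …, xₙ all lie in the cell iff the union U
of their discs is void. U is open, bounded and misses the origin, and under the Palm law such a set
is void with probability exp(-λ area U), as if there were no point at the origin (`palmLaw_void`).
Since the cell and the users are independent, Tonelli's theorem turns the n-th power of the load
into the integral of this probability against the n-th moment measure.

The probabilistic core is the void case of Slivnyak's theorem, obtained directly from Poisson counts
and independence on disjoint sets. For disjoint A and B, E[Φ(A); Φ(B) = 0] = λ|A| P(Φ(B) = 0)
(`setLIntegral_count_void`). The Palm law needs this with B = U + x moving with the point x of Φ. In
`compProd_void_eq_prod` the relation t - x ∈ U is a countable union of rectangles, so finitely many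
of them give a B that takes finitely many values as x varies. Continuity from above passes to the
limit. -/

namespace CellLoad

/-! ### Atoms of counting measures, and measurability of the cell. -/

namespace PointMeasure

/-- By outer regularity a non-atom has a neighbourhood of mass below 1; made bounded, it has integer
mass, which is therefore 0. Locally null sets are null because the plane is second countable. -/
theorem toMeasure_eq_zero_of_forall_not_isPoint (φ : PointMeasure) {U : Set Plane}
    (h : ∀ t ∈ U, ¬ φ.IsPoint t) : φ.toMeasure U = 0 := by
  refine measure_null_of_locally_null U fun t ht => ?_
  have h0 : φ.toMeasure {t} < 1 := by
    rw [not_not.1 (h t ht)]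
    exact one_pos
  obtain ⟨V, htV, hV, hV1⟩ := Set.exists_isOpen_lt_of_lt {t} 1 h0
  have htV' : t ∈ V := htV rfl
  refine ⟨V ∩ Metric.ball t 1, mem_nhdsWithin_of_mem_nhds
    (inter_mem (hV.mem_nhds htV') (Metric.ball_mem_nhds t one_pos)), ?_⟩
  obtain ⟨k, hk⟩ := φ.exists_count (hV.inter Metric.isOpen_ball).measurableSet
    (Metric.isBounded_ball.subset (inter_subset_right (s := V) (t := Metric.ball t 1)))
  have hk1 : (k : ℝ≥0∞) < 1 := hk ▸ (measure_mono inter_subset_left).trans_lt hV1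
  have : k = 0 := by
    have : k < 1 := by exact_mod_cast hk1
    omega
  rw [hk, this, Nat.cast_zero]

theorem toMeasure_eq_zero_iff (φ : PointMeasure) {U : Set Plane} :
    φ.toMeasure U = 0 ↔ ∀ t ∈ U, ¬ φ.IsPoint t :=
  ⟨fun h _ ht hp => hp (measure_mono_null (singleton_subset_iff.2 ht) h),
    φ.toMeasure_eq_zero_of_forall_not_isPoint⟩

/-- A location is in the cell of the origin iff the open disc around it that has the origin on its
boundary is empty. -/
theorem mem_cell_zero_iff (φ : PointMeasure) (y : Plane) :
    y ∈ φ.cell 0 ↔ φ.toMeasure (Metric.ball y ‖y‖) = 0 := by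
  rw [toMeasure_eq_zero_iff]
  refine forall_congr' fun t => ?_
  rw [sub_zero, Metric.mem_ball, dist_comm, dist_eq_norm]
  constructor
  · intro h h1 h2
    exact absurd (h h2) (not_le.2 h1)
  · intro h h1
    by_contra h2
    exact h (not_le.1 h2) h1

theorem measurableSet_mem_cell :
    MeasurableSet {p : PointMeasure × Plane | p.2 ∈ p.1.cell 0} := by
  have hs : MeasurableSet {q : (PointMeasure × Plane) × Plane | dist q.2 q.1.2 < ‖q.1.2‖} :=
    measurableSet_lt (measurable_snd.dist (measurable_snd.comp measurable_fst))
      (measurable_snd.comp measurable_fst).norm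
  have hm : Measurable fun p : PointMeasure × Plane => p.1.toMeasure (Metric.ball p.2 ‖p.2‖) :=
    Kernel.measurable_kernel_prodMk_left
      (κ := kernel.comap (Prod.fst : PointMeasure × Plane → PointMeasure) measurable_fst) hs
  simp_rw [mem_cell_zero_iff]
  exact hm (measurableSet_singleton 0)

theorem measurableSet_cell (φ : PointMeasure) : MeasurableSet (φ.cell 0) :=
  measurable_prodMk_left (x := φ) measurableSet_mem_cell

theorem measurable_toMeasure_cell :
    Measurable fun p : PointMeasure × PointMeasure => p.2.toMeasure (p.1.cell 0) :=
  Kernel.measurable_kernel_prodMk_left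
    (κ := kernel.comap (Prod.snd : PointMeasure × PointMeasure → PointMeasure) measurable_snd)
    (t := {q : (PointMeasure × PointMeasure) × Plane | q.2 ∈ q.1.1.cell 0})
    (((measurable_fst.comp measurable_fst).prodMk measurable_snd) measurableSet_mem_cell)

end PointMeasure

/-! ### Mean counts and void probabilities of the Poisson process. -/

theorem lintegral_natCast_poissonMeasure (r : ℝ≥0) :
    ∫⁻ k : ℕ, (k : ℝ≥0∞) ∂(poissonMeasure r) = r := by
  rw [lintegral_countable', tsum_eq_zero_add' ENNReal.summable]
  simp only [Nat.cast_zero, zero_mul, zero_add]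
  -- With p the Poisson weights, (k+1) p(k+1) = r p(k), so the mean is r times the total mass.
  have h : ∀ k : ℕ, ((k + 1 : ℕ) : ℝ≥0∞) * poissonMeasure r {k + 1}
      = r * poissonMeasure r {k} := fun k => by
    rw [poissonMeasure_singleton, poissonMeasure_singleton, ← ENNReal.ofReal_natCast,
      ← ENNReal.ofReal_coe_nnreal, ← ENNReal.ofReal_mul (by positivity),
      ← ENNReal.ofReal_mul (by positivity)]
    congr 1
    rw [Nat.factorial_succ]
    push_cast
    field_simp
    ring
  simp_rw [h]
  rw [ENNReal.tsum_mul_left]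
  have := lintegral_countable' (μ := poissonMeasure r) (fun _ : ℕ => (1 : ℝ≥0∞))
  simp only [one_mul, lintegral_const, measure_univ] at this
  rw [← this, mul_one]

namespace IsPoissonProcess

variable {Ω : Type*} [MeasurableSpace Ω] {P : Measure Ω} {lam : ℝ≥0} {Φ : Ω → PointMeasure}

theorem measurable_count (hΦ : IsPoissonProcess P lam Φ) {B : Set Plane} (hB : MeasurableSet B) :
    Measurable fun ω => (Φ ω).toMeasure B :=
  (PointMeasure.measurable_count hB).comp hΦ.measurable

theorem measurableSet_void (hΦ : IsPoissonProcess P lam Φ) {B : Set Plane} (hB : MeasurableSet B) :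
    MeasurableSet {ω | (Φ ω).toMeasure B = 0} :=
  hΦ.measurable_count hB (measurableSet_singleton 0)

theorem lintegral_count_of_isBounded (hΦ : IsPoissonProcess P lam Φ) {B : Set Plane}
    (hB : MeasurableSet B) (hb : Bornology.IsBounded B) :
    ∫⁻ ω, (Φ ω).toMeasure B ∂P = lam * volume B := by
  have h := lintegral_map (μ := P) (f := fun x : ℝ≥0∞ => x) measurable_id (hΦ.measurable_count hB)
  rw [← h, hΦ.map_count B hB hb, lintegral_map (f := fun x : ℝ≥0∞ => x) measurable_id .of_discrete,
    lintegral_natCast_poissonMeasure, ENNReal.coe_mul, ENNReal.coe_toNNReal hb.measure_lt_top.ne]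

theorem measure_void (hΦ : IsPoissonProcess P lam Φ) {B : Set Plane}
    (hB : MeasurableSet B) (hb : Bornology.IsBounded B) :
    P {ω | (Φ ω).toMeasure B = 0} = ENNReal.ofReal (Real.exp (-(lam * volume.real B))) := by
  have h := Measure.map_apply (μ := P) (hΦ.measurable_count hB) (measurableSet_singleton 0)
  have h0 : (fun k : ℕ => (k : ℝ≥0∞)) ⁻¹' {0} = {0} := by
    ext k
    simp
  rw [hΦ.map_count B hB hb, Measure.map_apply .of_discrete (measurableSet_singleton 0), h0,
    poissonMeasure_singleton] at h
  refine h.symm.trans ?_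
  simp [Measure.real, ENNReal.toReal]

/-- The counts on A and B are independent, so the expectation of Φ(A) times the indicator of
voidness of B factorises. -/
theorem setLIntegral_count_void_of_isBounded (hΦ : IsPoissonProcess P lam Φ) {A B : Set Plane}
    (hA : MeasurableSet A) (hAb : Bornology.IsBounded A) (hB : MeasurableSet B)
    (hb : Bornology.IsBounded B) (hAB : Disjoint A B) :
    ∫⁻ ω in {ω | (Φ ω).toMeasure B = 0}, (Φ ω).toMeasure A ∂P
      = lam * volume A * P {ω | (Φ ω).toMeasure B = 0} := by
  have hind : IndepFun (fun ω => (Φ ω).toMeasure A) (fun ω => (Φ ω).toMeasure B) P := by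
    have := hΦ.iIndepFun_count 2 ![A, B] (by simp [Fin.forall_fin_two, hA, hB])
      (by simp [Fin.forall_fin_two, hAb, hb]) (fun i j hij => by
        fin_cases i <;> fin_cases j <;> simp_all [hAB.symm])
    simpa using this.indepFun (i := 0) (j := 1) (by decide)
  have hf : Measurable (({0} : Set ℝ≥0∞).indicator (1 : ℝ≥0∞ → ℝ≥0∞)) :=
    measurable_one.indicator (measurableSet_singleton 0)
  have hm := lintegral_mul_eq_lintegral_mul_lintegral_of_indepFun''
    (hΦ.measurable_count hA).aemeasurable (hf.comp (hΦ.measurable_count hB)).aemeasurable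
    (hind.comp measurable_id hf)
  have h1 : ∀ ω, (({0} : Set ℝ≥0∞).indicator (1 : ℝ≥0∞ → ℝ≥0∞) ∘ fun ω => (Φ ω).toMeasure B) ω
      = {ω | (Φ ω).toMeasure B = 0}.indicator 1 ω := fun ω => rfl
  simp_rw [h1] at hm
  rw [lintegral_indicator_one (hΦ.measurableSet_void hB),
    hΦ.lintegral_count_of_isBounded hA hAb] at hm
  rw [← hm, ← lintegral_indicator (hΦ.measurableSet_void hB)]
  refine lintegral_congr fun ω => ?_
  by_cases hω : ω ∈ {ω | (Φ ω).toMeasure B = 0} <;> simp [hω]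

/-- Removes boundedness of A by monotone convergence along discs: the observation window of the Palm
law is only assumed to have finite area. -/
theorem setLIntegral_count_void (hΦ : IsPoissonProcess P lam Φ) {A B : Set Plane}
    (hA : MeasurableSet A) (hB : MeasurableSet B)
    (hb : Bornology.IsBounded B) (hAB : Disjoint A B) :
    ∫⁻ ω in {ω | (Φ ω).toMeasure B = 0}, (Φ ω).toMeasure A ∂P
      = lam * volume A * P {ω | (Φ ω).toMeasure B = 0} := by
  let D : ℕ → Set Plane := fun k => A ∩ Metric.ball 0 (k : ℝ)
  have hD : ∀ k, MeasurableSet (D k) := fun k => hA.inter Metric.isOpen_ball.measurableSet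
  have hmono : Monotone D := fun i j hij =>
    inter_subset_inter_right _ (Metric.ball_subset_ball (by exact_mod_cast hij))
  have hU : A = ⋃ k, D k := by rw [← inter_iUnion, Metric.iUnion_ball_nat, inter_univ]
  conv_lhs => rw [hU]
  conv_rhs => rw [hU]
  simp_rw [hmono.measure_iUnion]
  rw [lintegral_iSup (fun k => hΦ.measurable_count (hD k))
    (fun i j hij ω => measure_mono (hmono hij)), ENNReal.mul_iSup, ENNReal.iSup_mul]
  exact iSup_congr fun k => hΦ.setLIntegral_count_void_of_isBounded (hD k)
    (Metric.isBounded_ball.subset inter_subset_right) hB hb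
    (hAB.mono_left inter_subset_left)

theorem lintegral_count [IsProbabilityMeasure P] (hΦ : IsPoissonProcess P lam Φ) {A : Set Plane}
    (hA : MeasurableSet A) : ∫⁻ ω, (Φ ω).toMeasure A ∂P = lam * volume A := by
  simpa using hΦ.setLIntegral_count_void hA MeasurableSet.empty Bornology.isBounded_empty
    (disjoint_empty A)

end IsPoissonProcess

end CellLoad

/-! ### Slivnyak's theorem for void probabilities. -/

namespace CellLoad

/-- The translates of an open set are unions of members of a countable family of bounded open
sets, each of which is used for the translations in an open set. -/
theorem exists_countable_cover_translates {U : Set Plane} (hU : IsOpen U)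
    (hUb : Bornology.IsBounded U) :
    ∃ R Q : ℕ → Set Plane, (∀ j, IsOpen (R j)) ∧ (∀ j, IsOpen (Q j)) ∧
      (∀ j, Bornology.IsBounded (Q j)) ∧ ∀ x t, t - x ∈ U ↔ ∃ j, x ∈ R j ∧ t ∈ Q j := by
  let b := TopologicalSpace.countableBasis Plane
  have hb := TopologicalSpace.isBasis_countableBasis Plane
  have hbc : b.Countable := TopologicalSpace.countable_countableBasis Plane
  let T : Set (Set Plane × Set Plane) :=
    {p | p ∈ b ×ˢ b ∧ ∀ x ∈ p.1, ∀ t ∈ p.2, t - x ∈ U}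
  -- The extra pair makes the family nonempty, so that it can be enumerated by ℕ. It contributes
  -- nothing, its second member being empty.
  have hT : (insert (univ, ∅) T).Countable := ((hbc.prod hbc).mono fun p hp => hp.1).insert _
  obtain ⟨g, hg⟩ := hT.exists_eq_range (insert_nonempty _ _)
  have hgj : ∀ j, g j = (univ, ∅) ∨ g j ∈ T := fun j => by
    have : g j ∈ insert (univ, ∅) T := hg ▸ mem_range_self j
    exact this
  refine ⟨fun j => (g j).1, fun j => (g j).2, fun j => ?_, fun j => ?_, fun j => ?_,
    fun x t => ⟨fun h => ?_, ?_⟩⟩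
  · rcases hgj j with h | h
    · simp [h]
    · exact hb.isOpen h.1.1
  · rcases hgj j with h | h
    · simp [h]
    · exact hb.isOpen h.1.2
  · rcases hgj j with h | h
    · simp [h]
    -- A point x of the nonempty set R j gives Q j ⊆ U + x, which is bounded.
    · obtain ⟨x, hx⟩ := TopologicalSpace.nonempty_of_mem_countableBasis h.1.1
      refine ((LipschitzWith.of_dist_le_mul (K := 1) fun a b => by simp :
        LipschitzWith 1 fun y : Plane => y + x).isBounded_image hUb).subset fun t ht => ?_
      exact ⟨t - x, h.2 x hx t ht, sub_add_cancel t x⟩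
  · have hV : IsOpen ((fun p : Plane × Plane => p.2 - p.1) ⁻¹' U) :=
      hU.preimage (continuous_snd.sub continuous_fst)
    obtain ⟨V₁, V₂, h1, h2, hx, ht, hsub⟩ := isOpen_prod_iff.1 hV x t h
    obtain ⟨r, hr, hxr, hrV⟩ := hb.exists_subset_of_mem_open hx h1
    obtain ⟨q, hq, htq, hqV⟩ := hb.exists_subset_of_mem_open ht h2
    have hmem : (r, q) ∈ T := ⟨⟨hr, hq⟩, fun y hy z hz => hsub (mk_mem_prod (hrV hy) (hqV hz))⟩
    obtain ⟨j, hj⟩ : (r, q) ∈ range g := hg ▸ mem_insert_of_mem _ hmem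
    exact ⟨j, by simpa [hj] using hxr, by simpa [hj] using htq⟩
  · rintro ⟨j, hx, ht⟩
    rcases hgj j with h | h
    · simp [h] at ht
    · exact h.2 x hx t ht

namespace IsPoissonProcess

variable {Ω : Type*} [MeasurableSpace Ω] {P : Measure Ω} {lam : ℝ≥0} {Φ : Ω → PointMeasure}

/-- The Campbell measure of a Poisson process and the product measure give the same mass to the
pairs `(ω, x)` for which the translate by `x` of an open bounded set that does not contain the
origin is void. -/
theorem compProd_void_eq_prod [IsProbabilityMeasure P] (hΦ : IsPoissonProcess P lam Φ)
    {W : Set Plane} (hW : MeasurableSet W) (hWfin : volume W ≠ ∞) {U : Set Plane} (hU : IsOpen U)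
    (hUb : Bornology.IsBounded U) (h0 : (0 : Plane) ∉ U) :
    MeasurableSet {p : Ω × Plane | (Φ p.1).toMeasure ((fun y => y - p.2) ⁻¹' U) = 0} ∧
    (P ⊗ₘ ((PointMeasure.kernel.comap Φ hΦ.measurable).restrict hW))
        {p | (Φ p.1).toMeasure ((fun y => y - p.2) ⁻¹' U) = 0}
      = (P.prod (lam • volume.restrict W))
        {p | (Φ p.1).toMeasure ((fun y => y - p.2) ⁻¹' U) = 0} := by
  classical
  obtain ⟨R, Q, hR, hQ, hQb, hRQ⟩ := exists_countable_cover_translates hU hUb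
  set N := P ⊗ₘ ((PointMeasure.kernel.comap Φ hΦ.measurable).restrict hW) with hN
  set N' := P.prod (lam • volume.restrict W) with hN'
  have hrect : ∀ (F : Set Ω) (A : Set Plane), MeasurableSet F → MeasurableSet A →
      N (F ×ˢ A) = ∫⁻ ω in F, (Φ ω).toMeasure (A ∩ W) ∂P := fun F A hF hA => by
    rw [hN, Measure.compProd_apply_prod hF hA]
    simp_rw [Kernel.restrict_apply' _ hW _ hA]
    rfl
  have hrect' : ∀ (F : Set Ω) (A : Set Plane), MeasurableSet A →
      N' (F ×ˢ A) = lam * volume (A ∩ W) * P F := fun F A hA => by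
    rw [hN', Measure.prod_prod, Measure.smul_apply, Measure.restrict_apply hA, mul_comm]
    rfl
  -- Finiteness, from the finite area of the window, is needed for continuity from above at the end.
  have hfin : IsFiniteMeasure N := ⟨by
    rw [← univ_prod_univ, hrect _ _ .univ .univ, setLIntegral_univ, univ_inter,
      hΦ.lintegral_count hW]
    exact ENNReal.mul_lt_top ENNReal.coe_lt_top hWfin.lt_top⟩
  have hfin' : IsFiniteMeasure N' := ⟨by
    rw [← univ_prod_univ, hrect' _ _ .univ, univ_inter, measure_univ, mul_one]
    exact ENNReal.mul_lt_top ENNReal.coe_lt_top hWfin.lt_top⟩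
  -- Uses only the first m rectangles; the V m decrease to the event that U + x is void.
  let V : ℕ → Set (Ω × Plane) := fun m =>
    {p | ∀ j ∈ Finset.range m, p.2 ∈ R j → (Φ p.1).toMeasure (Q j) = 0}
  have hV : ∀ m, MeasurableSet (V m) := fun m => by
    have : V m = ⋂ j ∈ Finset.range m, {p | p.2 ∈ R j → (Φ p.1).toMeasure (Q j) = 0} := by
      ext p
      simp [V]
    rw [this]
    refine Finset.measurableSet_biInter _ fun j _ => MeasurableSet.imp ?_ ?_
    · exact measurable_snd (hR j).measurableSet
    · exact measurable_fst (hΦ.measurableSet_void (hQ j).measurableSet)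
  have hVanti : Antitone V := fun m k hmk p hp j hj =>
    hp j (Finset.range_mono hmk hj)
  have hVinf : {p : Ω × Plane | (Φ p.1).toMeasure ((fun y => y - p.2) ⁻¹' U) = 0} = ⋂ m, V m := by
    ext p
    have h1 : (fun y => y - p.2) ⁻¹' U = ⋃ j ∈ {j | p.2 ∈ R j}, Q j := by
      ext t
      simp only [mem_preimage, hRQ, mem_iUnion, mem_ofPred_eq, exists_prop]
    rw [mem_ofPred_eq, h1, measure_biUnion_null_iff (to_countable _)]
    simp only [mem_iInter, V, mem_ofPred_eq, Finset.mem_range]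
    exact ⟨fun h m j _ => h j, fun h j => h (j + 1) j (Nat.lt_succ_self j)⟩
  -- The point x matters only through the set σ of indices j < m with x ∈ R j. On each level set A σ
  -- the condition is voidness of the fixed set E, so V m splits into finitely many disjoint
  -- measurable rectangles.
  have hVeq : ∀ m, N (V m) = N' (V m) := fun m => by
    let s : Ω × Plane → Finset ℕ := fun p => (Finset.range m).filter fun j => p.2 ∈ R j
    let A : Finset ℕ → Set Plane := fun σ => {x | (Finset.range m).filter (fun j => x ∈ R j) = σ}
    have hA : ∀ σ, MeasurableSet (A σ) := fun σ => by
      have : A σ = ⋂ j : ℕ, {x | (j < m ∧ x ∈ R j) ↔ j ∈ σ} := by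
        ext x
        simp [A, Finset.ext_iff]
      rw [this]
      refine MeasurableSet.iInter fun j => MeasurableSet.iff ?_ (MeasurableSet.const _)
      exact (MeasurableSet.const _).inter (hR j).measurableSet
    have hs : ∀ σ, MeasurableSet (s ⁻¹' {σ}) := fun σ => measurable_snd (hA σ)
    have hsV : s ⁻¹' ((Finset.range m).powerset : Set (Finset ℕ)) = univ :=
      eq_univ_of_forall fun p =>
      show s p ∈ ((Finset.range m).powerset : Set (Finset ℕ)) from
        Finset.mem_coe.2 (Finset.mem_powerset.2 (Finset.filter_subset _ _))
    have hsum : ∀ M : Measure (Ω × Plane),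
        M (V m) = ∑ σ ∈ (Finset.range m).powerset, M (s ⁻¹' {σ} ∩ V m) := fun M => by
      have := sum_measure_preimage_singleton (μ := M.restrict (V m)) (Finset.range m).powerset
        (f := s) fun σ _ => hs σ
      rw [hsV, Measure.restrict_apply_univ] at this
      rw [← this]
      exact Finset.sum_congr rfl fun σ _ => Measure.restrict_apply (hs σ)
    rw [hsum N, hsum N']
    refine Finset.sum_congr rfl fun σ hσ => ?_
    let E : Set Plane := ⋃ j ∈ σ, Q j
    have hE : MeasurableSet E := Finset.measurableSet_biUnion _ fun j _ => (hQ j).measurableSet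
    have hEb : Bornology.IsBounded E := (Bornology.isBounded_biUnion_finset σ).2 fun j _ => hQb j
    have hrec : s ⁻¹' {σ} ∩ V m = {ω | (Φ ω).toMeasure E = 0} ×ˢ A σ := by
      ext p
      simp only [mem_inter_iff, mem_preimage, mem_singleton_iff, mem_prod, mem_ofPred_eq, V, E]
      rw [and_comm]
      refine and_congr_left fun hp => ?_
      rw [← hp]
      simp [s]
    rw [hrec, hrect _ _ (hΦ.measurableSet_void hE) (hA σ), hrect' _ _ (hA σ)]
    refine hΦ.setLIntegral_count_void ((hA σ).inter hW) hE hEb ?_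
    -- A common point x of A σ and E lies in R j ∩ Q j for some j, which forces 0 = x - x ∈ U.
    refine Set.disjoint_left.2 fun x hx hxE => h0 ?_
    obtain ⟨j, hj, hxQ⟩ : ∃ j ∈ σ, x ∈ Q j := by simpa [E] using hxE
    rw [← (hx.1 : _ = σ), Finset.mem_filter] at hj
    simpa using (hRQ x x).2 ⟨j, hj.2, hxQ⟩
  rw [hVinf]
  refine ⟨MeasurableSet.iInter hV, ?_⟩
  have h1 := tendsto_measure_iInter_atTop (μ := N) (fun m => (hV m).nullMeasurableSet) hVanti
    ⟨0, measure_ne_top _ _⟩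
  have h2 := tendsto_measure_iInter_atTop (μ := N') (fun m => (hV m).nullMeasurableSet) hVanti
    ⟨0, measure_ne_top _ _⟩
  exact tendsto_nhds_unique (h1.congr hVeq) h2

/-- Slivnyak's theorem for void probabilities. -/
theorem palmLaw_void [IsProbabilityMeasure P] (hΦ : IsPoissonProcess P lam Φ) (hlam : 0 < lam)
    {W : Set Plane} (hW : MeasurableSet W) (hW0 : volume W ≠ 0) (hWfin : volume W ≠ ∞)
    {U : Set Plane} (hU : IsOpen U) (hUb : Bornology.IsBounded U) (h0 : (0 : Plane) ∉ U) :
    palmLaw (P.map Φ) W {φ | φ.toMeasure U = 0}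
      = ENNReal.ofReal (Real.exp (-(lam * volume.real U))) := by
  obtain ⟨hmeas, heq⟩ := hΦ.compProd_void_eq_prod hW hWfin hU hUb h0
  have hrec : ∀ φ : PointMeasure, Measurable φ.recenter := fun φ =>
    PointMeasure.measurable_recenter.comp measurable_prodMk_left
  have hm : Measurable fun φ : PointMeasure => (φ.toMeasure.restrict W).map φ.recenter := by
    have h : ∀ φ : PointMeasure, (φ.toMeasure.restrict W).map φ.recenter
        = ((φ.toMeasure.restrict W).map fun x => (φ.recenter x, φ)).map Prod.fst := fun φ => by
      rw [Measure.map_map measurable_fst ((hrec φ).prodMk measurable_const)]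
      rfl
    simp_rw [h]
    exact (Measure.measurable_map _ measurable_fst).comp
      ((measurable_map_recenter hW).comp (measurable_id.prodMk measurable_id))
  have hS : MeasurableSet {φ : PointMeasure | φ.toMeasure U = 0} :=
    PointMeasure.measurable_count hU.measurableSet (measurableSet_singleton 0)
  have hrecU : ∀ (φ : PointMeasure) (x : Plane),
      (φ.recenter x).toMeasure U = φ.toMeasure ((fun y => y - x) ⁻¹' U) := fun φ x =>
    Measure.map_apply (measurable_sub_const x) hU.measurableSet
  have hcampbell : ∀ ω, ((Φ ω).toMeasure.restrict W).map (Φ ω).recenter {φ | φ.toMeasure U = 0}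
      = ((PointMeasure.kernel.comap Φ hΦ.measurable).restrict hW) ω
        (Prod.mk ω ⁻¹' {p | (Φ p.1).toMeasure ((fun y => y - p.2) ⁻¹' U) = 0}) := fun ω => by
    rw [Measure.map_apply (hrec _) hS, Kernel.restrict_apply]
    simp_rw [← hrecU]
    rfl
  have hvoid : ∀ x : Plane, P {ω | (Φ ω).toMeasure ((fun y => y - x) ⁻¹' U) = 0}
      = ENNReal.ofReal (Real.exp (-(lam * volume.real U))) := fun x => by
    have hvol : volume ((fun y => y - x) ⁻¹' U) = volume U := by
      simp_rw [sub_eq_add_neg]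
      exact measure_preimage_add_right volume (-x) U
    have hbd : Bornology.IsBounded ((fun y => y - x) ⁻¹' U) := by
      refine ((LipschitzWith.of_dist_le_mul (K := 1) fun a b => by simp :
        LipschitzWith 1 fun y : Plane => y + x).isBounded_image hUb).subset fun t ht => ?_
      exact ⟨t - x, ht, sub_add_cancel t x⟩
    rw [hΦ.measure_void (measurable_sub_const x hU.measurableSet) hbd, Measure.real, hvol]
    rfl
  rw [palmLaw, Measure.smul_apply, Measure.bind_apply hS hm.aemeasurable,
    lintegral_map (PointMeasure.measurable_count hW) hΦ.measurable,
    lintegral_map (f := fun φ : PointMeasure =>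
      (φ.toMeasure.restrict W).map φ.recenter {φ | φ.toMeasure U = 0})
      ((Measure.measurable_coe hS).comp hm) hΦ.measurable, hΦ.lintegral_count hW]
  simp_rw [hcampbell]
  -- Once the Campbell measure is replaced by the product measure, one may integrate over ω first.
  -- By translation invariance of area each section has the same void probability, and the factor
  -- λ|W| cancels.
  rw [← Measure.compProd_apply hmeas, heq, Measure.prod_apply_symm hmeas]
  have hsec : ∀ x : Plane, P ((fun ω => (ω, x)) ⁻¹'
      {p | (Φ p.1).toMeasure ((fun y => y - p.2) ⁻¹' U) = 0})
      = ENNReal.ofReal (Real.exp (-(lam * volume.real U))) := hvoid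
  simp_rw [hsec]
  rw [lintegral_const, Measure.smul_apply, Measure.restrict_apply_univ,
    show lam • volume W = (lam : ℝ≥0∞) * volume W from rfl, smul_eq_mul,
    mul_comm (ENNReal.ofReal _), ← mul_assoc, ENNReal.inv_mul_cancel, one_mul]
  · exact mul_ne_zero (by exact_mod_cast hlam.ne') hW0
  · exact ENNReal.mul_ne_top ENNReal.coe_ne_top hWfin

end IsPoissonProcess

end CellLoad

/-! ### From void probabilities to moments of the load. -/

namespace CellLoad

/-- Open and closed discs with the origin on their boundary have unions of the same area. -/
theorem volume_iUnion_ball_eq {n : ℕ} (x : Fin n → Plane) :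
    volume (⋃ i, Metric.ball (x i) ‖x i‖) = volume (⋃ i, Metric.closedBall (x i) ‖x i‖) := by
  refine measure_congr (Filter.EventuallyEq.countable_iUnion fun i => ?_)
  refine ae_eq_of_subset_of_measure_ge Metric.ball_subset_closedBall ?_
    Metric.isOpen_ball.measurableSet.nullMeasurableSet
    (Metric.isBounded_closedBall.measure_lt_top).ne
  rw [Measure.addHaar_closedBall_eq_addHaar_ball]

variable {Ω : Type*} [MeasurableSpace Ω] {P : Measure Ω}

theorem momentMeasure_pi_const {Φ : Ω → PointMeasure} (hΦ : Measurable Φ) (n : ℕ)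
    {B : Set Plane} (hB : MeasurableSet B) :
    momentMeasure P Φ n (univ.pi fun _ => B) = ∫⁻ ω, (Φ ω).toMeasure B ^ n ∂P := by
  rw [momentMeasure_pi hΦ n _ fun _ => hB]
  simp

theorem lintegral_momentMeasure {Φ : Ω → PointMeasure} (hΦ : Measurable Φ) (n : ℕ)
    {g : (Fin n → Plane) → ℝ≥0∞} (hg : Measurable g) :
    ∫⁻ x, g x ∂(momentMeasure P Φ n)
      = ∫⁻ ω, ∫⁻ x, g x ∂(Measure.pi fun _ : Fin n => (Φ ω).toMeasure) ∂P :=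
  Measure.lintegral_bind ((PointMeasure.measurable_pi n).comp hΦ).aemeasurable hg.aemeasurable

theorem measurableSet_forall_mem_cell (n : ℕ) :
    MeasurableSet {q : PointMeasure × (Fin n → Plane) | ∀ i, q.2 i ∈ q.1.cell 0} := by
  simp_rw [ofPred_forall]
  refine MeasurableSet.iInter fun i => ?_
  have h : Measurable fun q : PointMeasure × (Fin n → Plane) => (q.1, q.2 i) :=
    measurable_fst.prodMk ((measurable_pi_apply i).comp measurable_snd)
  exact h PointMeasure.measurableSet_mem_cell

end CellLoad

theorem theorem1 {Ω : Type*} [MeasurableSpace Ω] (P : Measure Ω) [IsProbabilityMeasure P]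
    (lam : ℝ≥0) (hlam : 0 < lam) (Φb Φu : Ω → PointMeasure)
    (hb : IsPoissonProcess P lam Φb) (hu : Measurable Φu) (hind : IndepFun Φb Φu P)
    (W : Set Plane) (hW : MeasurableSet W) (hW0 : volume W ≠ 0) (hWfin : volume W ≠ ∞) (n : ℕ) :
    ∫⁻ p, cellLoad p ^ n ∂(typicalLaw P Φb Φu W)
        = ∫⁻ p, momentMeasure P Φu n (Set.univ.pi fun _ => p.1.cell 0) ∂(typicalLaw P Φb Φu W)
      ∧ ∫⁻ p, cellLoad p ^ n ∂(typicalLaw P Φb Φu W)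
        = ∫⁻ x, ENNReal.ofReal (Real.exp
            (-(lam * volume.real (⋃ i, Metric.closedBall (x i) ‖x i‖)))) ∂(momentMeasure P Φu n) := by
  have hpr : IsProbabilityMeasure (P.map Φu) := Measure.isProbabilityMeasure_map hu.aemeasurable
  rw [typicalLaw_eq_prod hb.measurable hu hind hW]
  set palm := palmLaw (P.map Φb) W with hpalm
  -- The void event of the empty set is everything, so `palmLaw_void` gives total mass exp 0 = 1.
  have hprob : IsProbabilityMeasure palm := ⟨by
    simpa using hb.palmLaw_void hlam hW hW0 hWfin isOpen_empty Bornology.isBounded_empty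
      (notMem_empty _)⟩
  have hload : Measurable fun p : PointMeasure × PointMeasure => cellLoad p ^ n :=
    PointMeasure.measurable_toMeasure_cell.pow_const n
  have hmom : ∀ φ : PointMeasure, momentMeasure P Φu n (univ.pi fun _ => φ.cell 0)
      = ∫⁻ ψ, cellLoad (φ, ψ) ^ n ∂(P.map Φu) := fun φ => by
    rw [momentMeasure_pi_const hu n φ.measurableSet_cell]
    exact (lintegral_map (hload.comp measurable_prodMk_left) hu).symm
  have hleft : ∫⁻ p, cellLoad p ^ n ∂(palm.prod (P.map Φu))
      = ∫⁻ φ, ∫⁻ ψ, cellLoad (φ, ψ) ^ n ∂(P.map Φu) ∂palm :=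
    lintegral_prod _ hload.aemeasurable
  have hinner : Measurable fun φ : PointMeasure => ∫⁻ ψ, cellLoad (φ, ψ) ^ n ∂(P.map Φu) :=
    hload.lintegral_prod_right'
  constructor
  · rw [hleft, lintegral_prod _ (by
      simp_rw [hmom]
      exact (hinner.comp measurable_fst).aemeasurable)]
    simp [hmom]
  · let S : Set (PointMeasure × (Fin n → Plane)) := {q | ∀ i, q.2 i ∈ q.1.cell 0}
    have hS : MeasurableSet S := measurableSet_forall_mem_cell n
    have hvoid : ∀ x : Fin n → Plane, palm ((fun φ => (φ, x)) ⁻¹' S)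
        = ENNReal.ofReal (Real.exp
            (-(lam * volume.real (⋃ i, Metric.closedBall (x i) ‖x i‖)))) := fun x => by
      have h1 : (fun φ => (φ, x)) ⁻¹' S
          = {φ | φ.toMeasure (⋃ i, Metric.ball (x i) ‖x i‖) = 0} := by
        ext φ
        simp [S, PointMeasure.mem_cell_zero_iff, measure_iUnion_null_iff]
      -- The open discs have the origin on their boundary, so their union misses it; closing them
      -- does not change the area.
      rw [h1, hb.palmLaw_void hlam hW hW0 hWfin (isOpen_iUnion fun i => Metric.isOpen_ball)
        (Bornology.isBounded_iUnion.2 fun i => Metric.isBounded_ball) (by simp),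
        Measure.real, volume_iUnion_ball_eq]
      rfl
    have hg : Measurable fun x : Fin n → Plane => palm ((fun φ => (φ, x)) ⁻¹' S) :=
      measurable_measure_prodMk_right hS
    simp_rw [← hvoid]
    rw [lintegral_momentMeasure hu n hg, lintegral_prod_symm' _ hload,
      lintegral_map hload.lintegral_prod_left' hu]
    refine lintegral_congr fun ω => ?_
    -- For a fixed user configuration both sides are the mass of S under the Palm law times the
    -- n-fold product of the user measure. Sections over x are void probabilities; sections over φ
    -- are cubes of the cell, of mass the n-th power of the load.
    rw [← Measure.prod_apply_symm hS, Measure.prod_apply hS]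
    refine lintegral_congr fun φ => ?_
    have h2 : Prod.mk φ ⁻¹' S = univ.pi fun _ => φ.cell 0 := by
      ext x
      simp [S]
    rw [h2, Measure.pi_pi, Finset.prod_const, Finset.card_univ, Fintype.card_fin]
    rfl
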